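/- Let $p,q\ge 1$, $0\le k\le\min(p,q)$ and $B=[0,1]^2$. Let $\mathrm S=(s_{-p},\dots,s_{N_1+p+1})$ be an open knot vector, i.e. $0=s_{-p}=\dots=s_0<s_1\le\dots\le s_{N_1}<s_{N_1+1}=\dots=s_{N_1+p+1}=1$, let $\mathrm T$ be an open knot vector for degree $q$ with $N_2$ interior knots, and let $\mathcal S$ be the span of the tensor-product B-splines $B^p_i[\mathrm S](s)\,B^q_j[\mathrm T](t)$ on $B$, $0\le i\le N_1+p$, $0\le j\le N_2+q$. Assume $\mathcal S\subset C^k(B)$. Let $u(s,t)=(s,st)$, which maps $B$ onto the triangle $\Delta=\{(x,y):0\le x\le1,\ 0\le y\le x\}$ and collapses the edge $\mathbf S=\{0\}\times[0,1]$. Call $f\in\mathcal S$ equivalent to a real bivariate polynomial $\varrho$ of total degree at most $k$ if $$\frac{\partial^{\alpha_1+\alpha_2}f}{\partial s^{\alpha_1}\partial t^{\alpha_2}}=\frac{\partial^{\alpha_1+\alpha_2}(\varrho\circ u)}{\partial s^{\alpha_1}\partial t^{\alpha_2}}\quad\text{on }\mathbf S\text{ for all }0\le\alpha_1,\alpha_2\le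 k,$$ and let $\mathcal S^k(u,\mathbf S)$ be the set of all $f\in\mathcal S$ that are equivalent to some such polynomial. Let $g_0,g_1,g_2\in\mathcal S^k(u,\mathbf S)$ with $g_0>0$ on $B$, and let $G=(g_1/g_0,\,g_2/g_0):B\to\mathbb R^2$. Assume that $G$ is injective on $B$ up to the collapsed edge (if $G(s,t)=G(s',t')$, then $(s,t)=(s',t')$ or $s=s'=0$) and that $G$ is regular for $s>0$, i.e. $\det\nabla G(s,t)\ne0$ for all $s\in(0,1]$, $t\in[0,1]$. Let $\Omega=G((0,1)^2)$ and let $$\mathcal V^k=\Big\{\varphi:\Omega\to\mathbb R\ :\ \varphi=\tfrac{f}{g_0}\circ G^{-1},\ f\in\mathcal S^k(u,\mathbf S)\Big\}.$$ Suppose that $g_0,g_1,g_2$ are equivalent to polynomials $\varrho_0,\varrho_1,\varrho_2$ of total degree at most $k$, respectively, where $\varrho_0$ has no zero in $\Delta$ and the rational triangular patch $(\varrho_1/\varrho_0,\,\varrho_2/\varrho_0)$ is regular in $\Delta$, i.e. its Jacobian determinant does not vanish at any point of $\Delta$. Then $\mathcal V^k\subset\mathscr C^k(\overline\Omega)$: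 every $\varphi\in\mathcal V^k$ is $k$ times continuously differentiable on $\Omega$, and for all $\alpha_1+\alpha_2\le k$ and all $x\in\partial\Omega=\overline\Omega\setminus\Omega$ the limit of $\dfrac{\partial^{\alpha_1+\alpha_2}\varphi}{\partial x_1^{\alpha_1}\partial x_2^{\alpha_2}}(y)$ as $y\to x$, $y\in\Omega$, exists and is unique. -/

import Mathlib

open Set Filter Topology

noncomputable section

namespace SingularPatch

/-- An open knot vector `(s_{-p}, …, s_{N+p+1})` on the unit interval,
`0 = s_{-p} = … = s_0 < s_1 ≤ … ≤ s_N < s_{N+1} = … = s_{N+p+1} = 1`.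
The values at indices outside `-p, …, N+p+1` play no role. -/
structure OpenKnotVector (p N : ℕ) where
  knot : ℤ → ℝ
  knot_eq_zero : ∀ i : ℤ, -(p : ℤ) ≤ i → i ≤ 0 → knot i = 0
  first_lt : knot 0 < knot 1
  knot_le : ∀ i : ℤ, 1 ≤ i → i + 1 ≤ N → knot i ≤ knot (i + 1)
  last_lt : knot N < knot (N + 1)
  knot_eq_one : ∀ i : ℤ, (N : ℤ) + 1 ≤ i → i ≤ N + p + 1 → knot i = 1

/-- The B-spline `b[s_{i-d}, …, s_i, s_{i+1}]` of degree `d`, by the Cox - de Boor recursion with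
the usual convention that a quotient with denominator `0` is `0`. The basis functions of degree `0`
are the indicators of `[s_i, s_{i+1})`, the last nonempty interval being closed at the right end
`1` of the parameter domain. -/
def bspline (s : ℤ → ℝ) : ℕ → ℤ → ℝ → ℝ
  | 0, i, x =>
      open Classical in
      if (s i ≤ x ∧ x < s (i + 1)) ∨ (s i < s (i + 1) ∧ s (i + 1) = 1 ∧ x = 1) then 1 else 0
  | d + 1, i, x =>
      (x - s (i - (d + 1))) / (s i - s (i - (d + 1))) * bspline s d (i - 1) x
        + (s (i + 1) - x) / (s (i + 1) - s (i - d)) * bspline s d i x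

/-- The parameter domain `[0,1]²`. -/
def box : Set (ℝ × ℝ) := Icc 0 1 ×ˢ Icc 0 1

/-- The interior `]0,1[²` of the parameter domain. -/
def openBox : Set (ℝ × ℝ) := Ioo 0 1 ×ˢ Ioo 0 1

/-- The triangle `{(u, v) : 0 ≤ u ≤ 1, 0 ≤ v ≤ u}`. -/
def triangle : Set (ℝ × ℝ) := {x | 0 ≤ x.1 ∧ x.1 ≤ 1 ∧ 0 ≤ x.2 ∧ x.2 ≤ x.1}

/-- The tensor-product B-spline space of degree `(p, q)`, spanned by the products
`B^p_i[S](s) B^q_j[T](t)` with `0 ≤ i ≤ N₁ + p` and `0 ≤ j ≤ N₂ + q`. Only the values on the box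
are meaningful. -/
def splineSpace {p q N₁ N₂ : ℕ} (S : OpenKnotVector p N₁) (T : OpenKnotVector q N₂) :
    Submodule ℝ (ℝ × ℝ → ℝ) :=
  Submodule.span ℝ
    {f | ∃ i j : ℕ, i ≤ N₁ + p ∧ j ≤ N₂ + q ∧
      f = fun x => bspline S.knot p i x.1 * bspline T.knot q j x.2}

/-- The mixed partial derivative `∂^(a+b) f / ∂s^a ∂t^b` of a function on the box, one-sided on the
boundary of the box. -/
def boxDeriv (a b : ℕ) (f : ℝ × ℝ → ℝ) (x : ℝ × ℝ) : ℝ :=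
  iteratedDerivWithin a
    (fun s => iteratedDerivWithin b (fun t => f (s, t)) (Icc 0 1) x.2) (Icc 0 1) x.1

/-- The mixed partial derivative `∂^(a+b) φ / ∂x₁^a ∂x₂^b` of a function near a point of an open
subset of the plane. -/
def planeDeriv (a b : ℕ) (φ : ℝ × ℝ → ℝ) (x : ℝ × ℝ) : ℝ :=
  iteratedDeriv a (fun x₁ => iteratedDeriv b (fun x₂ => φ (x₁, x₂)) x.2) x.1

/-- The bilinear map `u(s, t) = (s, s t)`, which collapses the edge `s = 0`. -/
def collapse (x : ℝ × ℝ) : ℝ × ℝ := (x.1, x.1 * x.2)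

/-- The function on the plane given by a polynomial in two variables. -/
def polyFun (ϱ : MvPolynomial (Fin 2) ℝ) (x : ℝ × ℝ) : ℝ := MvPolynomial.eval ![x.1, x.2] ϱ

/-- `f` is equivalent to `ϱ` to order `k` at the edge `{0} × [0,1]`: all partial derivatives of `f`
and of `ϱ ∘ u` of order at most `k` in each variable agree there. -/
def EquivAtEdge (k : ℕ) (f : ℝ × ℝ → ℝ) (ϱ : MvPolynomial (Fin 2) ℝ) : Prop :=
  ∀ a b : ℕ, a ≤ k → b ≤ k → ∀ x ∈ ({0} ×ˢ Icc 0 1 : Set (ℝ × ℝ)),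
    boxDeriv a b f x = boxDeriv a b (polyFun ϱ ∘ collapse) x

/-- The space of the splines that are equivalent to order `k`, at the edge `{0} × [0,1]`, to a
polynomial of total degree at most `k` on the triangle. -/
def constrainedSpace {p q N₁ N₂ : ℕ} (k : ℕ) (S : OpenKnotVector p N₁)
    (T : OpenKnotVector q N₂) : Set (ℝ × ℝ → ℝ) :=
  {f | f ∈ splineSpace S T ∧
    ∃ ϱ ∈ MvPolynomial.restrictTotalDegree (Fin 2) ℝ k, EquivAtEdge k f ϱ}

/-- The planar rational map `(g₁ / g₀, g₂ / g₀)`. -/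
def ratMap (g : Fin 3 → ℝ × ℝ → ℝ) (x : ℝ × ℝ) : ℝ × ℝ := (g 1 x / g 0 x, g 2 x / g 0 x)

/-- The map `H`, with domain `D`, is regular on `A`: its Jacobian determinant does not vanish at
any point of `A`. (At a point where `H` is not differentiable the derivative below is `0`, so that
the condition fails.) -/
def IsRegularOn (H : ℝ × ℝ → ℝ × ℝ) (D A : Set (ℝ × ℝ)) : Prop :=
  ∀ x ∈ A, (fderivWithin ℝ H D x).det ≠ 0

/-- The physical domain `Ω = G(]0,1[²)`. -/
def physicalDomain (G : ℝ × ℝ → ℝ × ℝ) : Set (ℝ × ℝ) := G '' openBox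

/-- The isogeometric functions `φ = (f / g₀) ∘ G⁻¹` on `Ω`, `G = (g₁ / g₀, g₂ / g₀)`, with
numerator `f` in the set `W`; `G⁻¹ : Ω → ]0,1[²` is the inverse of `G` on the open box. Only the
values of `φ` on `Ω` are meaningful. -/
def isogeometricSpace (g : Fin 3 → ℝ × ℝ → ℝ) (W : Set (ℝ × ℝ → ℝ)) : Set (ℝ × ℝ → ℝ) :=
  {φ | ∃ f ∈ W, EqOn φ ((fun x => f x / g 0 x) ∘ Function.invFunOn (ratMap g) openBox)
    (physicalDomain (ratMap g))}

/-- The space of the functions of class `C^k` on `Ω` all of whose partial derivatives of order at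
most `k` have a unique limit at every point of `∂Ω = closure Ω \ Ω`. -/
def CkClosure (k : ℕ) (Ω : Set (ℝ × ℝ)) : Set (ℝ × ℝ → ℝ) :=
  {φ | ContDiffOn ℝ k φ Ω ∧
    ∀ x ∈ closure Ω \ Ω, ∀ a b : ℕ, a + b ≤ k →
      ∃! l : ℝ, Tendsto (planeDeriv a b φ) (𝓝[Ω] x) (𝓝 l)}

end SingularPatch

end

namespace SingularPatch

/-! The collapse is undone by working on the triangle with `f ∘ u⁻¹` in place of `f`. Near `s = 0` a
spline is a polynomial `∑ c_a(t) s^a` with coefficients of class `C^k`, and so is `ϱ ∘ u`;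
equivalence makes the coefficients with `a ≤ k` agree. Hence, near the vertex, `f ∘ u⁻¹ - ϱ` is a
finite sum of terms `h(y/x) x^a` with `a > k`, and at most `k` differentiations leave a bounded
factor times a positive power of `x` (`hasJetLimits_mul_pow`, `hasJetLimits_remainder`). So the
derivatives of `f ∘ u⁻¹` up to order `k` tend to those of `ϱ` at the vertex; elsewhere on the
triangle `u⁻¹` is smooth and the limits come from the box.

The components of `G ∘ u⁻¹` therefore have limiting derivatives on the whole closed triangle, and
its Jacobian has nonzero limits: at the vertex that of the rational triangular patch, elsewhere by
regularity of `G`. Since `φ ∘ (G ∘ u⁻¹) = (f / g₀) ∘ u⁻¹`, Cramer's rule applied to the chain rule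
gives the derivatives of `φ`, one order at a time (`HasJetLimits.dirDeriv_comp`). Finally `u ∘ G⁻¹`
converges at each point of the closure of `Ω`, although `G⁻¹` itself need not
(`exists_tendsto_collapse_invFunOn`), so limits along the triangle become limits along `Ω`. -/

/-- The directional derivative of `f` in the direction `v`, as a function. -/
noncomputable def dirDeriv (v : ℝ × ℝ) (f : ℝ × ℝ → ℝ) (z : ℝ × ℝ) : ℝ := fderiv ℝ f z v

/-- At the point `x` of the closure of the open set `U`, the function `f` is of class `C^j` on `U`
near `x`, and all its iterated directional derivatives of order at most `j` have limits along `U`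
that belong to `A`. -/
def HasJetLimits (A : AddSubgroup ℝ) (U : Set (ℝ × ℝ)) (x : ℝ × ℝ) : ℕ → (ℝ × ℝ → ℝ) → Prop
  | 0, f => ∃ c ∈ A, Tendsto f (𝓝[U] x) (𝓝 c)
  | j + 1, f => (∃ c ∈ A, Tendsto f (𝓝[U] x) (𝓝 c)) ∧
      (∀ᶠ z in 𝓝[U] x, DifferentiableAt ℝ f z) ∧ ∀ v, HasJetLimits A U x j (dirDeriv v f)

/-! ### Algebra of functions whose derivatives have limits -/

namespace HasJetLimits

variable {A : AddSubgroup ℝ} {U : Set (ℝ × ℝ)} {x : ℝ × ℝ} {j : ℕ} {f g : ℝ × ℝ → ℝ}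

theorem tendsto (h : HasJetLimits A U x j f) : ∃ c ∈ A, Tendsto f (𝓝[U] x) (𝓝 c) := by
  cases j with
  | zero => exact h
  | succ j => exact h.1

/-- The subgroup serves in two cases: `⊥` says that all limits vanish, `⊤` only that they exist. -/
theorem mono_subgroup {B : AddSubgroup ℝ} (hAB : A ≤ B) (h : HasJetLimits A U x j f) :
    HasJetLimits B U x j f := by
  induction j generalizing f with
  | zero => exact ⟨_, hAB h.choose_spec.1, h.choose_spec.2⟩
  | succ j ih => exact ⟨⟨_, hAB h.1.choose_spec.1, h.1.choose_spec.2⟩, h.2.1, fun v => ih (h.2.2 v)⟩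

theorem pred (h : HasJetLimits A U x (j + 1) f) : HasJetLimits A U x j f := by
  induction j generalizing f with
  | zero => exact h.1
  | succ j ih => exact ⟨h.1, h.2.1, fun v => ih (h.2.2 v)⟩

theorem mono {i : ℕ} (hij : i ≤ j) (h : HasJetLimits A U x j f) : HasJetLimits A U x i f := by
  induction j, hij using Nat.le_induction with
  | base => exact h
  | succ j _ ih => exact ih h.pred

/-- This lets an identity valid along `U` be differentiated. -/
theorem eventually_nhds (hU : IsOpen U) {P : ℝ × ℝ → Prop} (h : ∀ᶠ z in 𝓝[U] x, P z) :
    ∀ᶠ z in 𝓝[U] x, ∀ᶠ w in 𝓝 z, P w := by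
  filter_upwards [eventually_eventually_nhdsWithin.2 h, self_mem_nhdsWithin] with z hz hzU
  rwa [hU.nhdsWithin_eq hzU] at hz

theorem congr (hU : IsOpen U) (h : HasJetLimits A U x j f) (hfg : f =ᶠ[𝓝[U] x] g) :
    HasJetLimits A U x j g := by
  induction j generalizing f g with
  | zero => exact ⟨_, h.choose_spec.1, h.choose_spec.2.congr' hfg⟩
  | succ j ih =>
    have hev := eventually_nhds hU hfg
    refine ⟨⟨_, h.1.choose_spec.1, h.1.choose_spec.2.congr' hfg⟩, ?_, fun v => ih (h.2.2 v) ?_⟩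
    · filter_upwards [hev, h.2.1] with z hz hd
      exact (EventuallyEq.differentiableAt_iff hz).1 hd
    · filter_upwards [hev] with z hz
      simp only [dirDeriv]
      rw [EventuallyEq.fderiv_eq hz]

theorem add (hU : IsOpen U) (hf : HasJetLimits A U x j f) (hg : HasJetLimits A U x j g) :
    HasJetLimits A U x j (fun z => f z + g z) := by
  induction j generalizing f g with
  | zero =>
    obtain ⟨c, hc, h⟩ := hf
    obtain ⟨d, hd, h'⟩ := hg
    exact ⟨_, A.add_mem hc hd, h.add h'⟩
  | succ j ih =>
    obtain ⟨⟨c, hc, h⟩, hf1, hf2⟩ := hf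
    obtain ⟨⟨d, hd, h'⟩, hg1, hg2⟩ := hg
    refine ⟨⟨_, A.add_mem hc hd, h.add h'⟩, ?_, fun v => (ih (hf2 v) (hg2 v)).congr hU ?_⟩
    · filter_upwards [hf1, hg1] with z h1 h2 using h1.add h2
    · filter_upwards [hf1, hg1] with z h1 h2
      simp only [dirDeriv]
      rw [fderiv_fun_add h1 h2]
      rfl

theorem zero : HasJetLimits A U x j (fun _ => 0) := by
  induction j with
  | zero => exact ⟨0, A.zero_mem, tendsto_const_nhds⟩
  | succ j ih =>
    refine ⟨⟨0, A.zero_mem, tendsto_const_nhds⟩, Eventually.of_forall fun z => by fun_prop, ?_⟩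
    intro v
    have : dirDeriv v (fun _ => 0) = fun _ => 0 := by
      ext z
      simp [dirDeriv]
    rwa [this]

theorem sum (hU : IsOpen U) {ι : Type*} (s : Finset ι) {F : ι → ℝ × ℝ → ℝ}
    (h : ∀ i ∈ s, HasJetLimits A U x j (F i)) :
    HasJetLimits A U x j (fun z => ∑ i ∈ s, F i z) := by
  classical
  induction s using Finset.induction_on with
  | empty => simpa using zero
  | insert i s hi ih =>
    simp only [Finset.sum_insert hi]
    exact (h i (Finset.mem_insert_self i s)).add hU
      (ih fun a ha => h a (Finset.mem_insert_of_mem ha))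

theorem mul (hU : IsOpen U) (hf : HasJetLimits ⊤ U x j f) (hg : HasJetLimits ⊤ U x j g) :
    HasJetLimits ⊤ U x j (fun z => f z * g z) := by
  induction j generalizing f g with
  | zero =>
    obtain ⟨c, hc, h⟩ := hf
    obtain ⟨d, hd, h'⟩ := hg
    exact ⟨_, trivial, h.mul h'⟩
  | succ j ih =>
    have hf0 := hf.pred
    have hg0 := hg.pred
    obtain ⟨⟨c, hc, h⟩, hf1, hf2⟩ := hf
    obtain ⟨⟨d, hd, h'⟩, hg1, hg2⟩ := hg
    refine ⟨⟨_, trivial, h.mul h'⟩, ?_,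
      fun v => ((ih hf0 (hg2 v)).add hU (ih hg0 (hf2 v))).congr hU ?_⟩
    · filter_upwards [hf1, hg1] with z h1 h2 using h1.mul h2
    · filter_upwards [hf1, hg1] with z h1 h2
      simp only [dirDeriv]
      rw [fderiv_fun_mul h1 h2]
      rfl

theorem inv (hU : IsOpen U) (hf : HasJetLimits ⊤ U x j f) {c : ℝ} (hc : c ≠ 0)
    (hlim : Tendsto f (𝓝[U] x) (𝓝 c)) : HasJetLimits ⊤ U x j (fun z => (f z)⁻¹) := by
  induction j with
  | zero => exact ⟨_, trivial, hlim.inv₀ hc⟩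
  | succ j ih =>
    have hne : ∀ᶠ z in 𝓝[U] x, f z ≠ 0 := hlim.eventually_ne hc
    have h1 := ih hf.pred
    refine ⟨⟨_, trivial, hlim.inv₀ hc⟩, ?_, fun v => ?_⟩
    · filter_upwards [hf.2.1, hne] with z h1 h2 using h1.inv h2
    -- The derivative of `1/f` is `(1/f)²` times `-f'`, and `-f'` is the derivative in the direction
    -- `-v`.
    · have hneg : HasJetLimits ⊤ U x j (fun z => dirDeriv (-v) f z) := hf.2.2 (-v)
      refine (((h1.mul hU h1)).mul hU hneg).congr hU ?_
      filter_upwards [hf.2.1, hne] with z h2 h3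
      have hd := (hasDerivAt_inv h3).comp_hasFDerivAt z h2.hasFDerivAt
      have hd' : fderiv ℝ (fun z => (f z)⁻¹) z = _ := hd.fderiv
      simp only [dirDeriv]
      rw [hd']
      simp [pow_two]

theorem of_contDiffOn {K : Set (ℝ × ℝ)} (hU : IsOpen U) (hUK : U ⊆ K) (hK : UniqueDiffOn ℝ K)
    (hx : x ∈ K) (hf : ContDiffOn ℝ j f K) : HasJetLimits ⊤ U x j f := by
  induction j generalizing f with
  | zero => exact ⟨_, trivial, (hf.continuousOn x hx).mono_left (nhdsWithin_mono _ hUK)⟩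
  | succ j ih =>
    refine ⟨⟨_, trivial, (hf.continuousOn x hx).mono_left (nhdsWithin_mono _ hUK)⟩, ?_,
      fun v => (ih (f := fun z => fderivWithin ℝ f K z v) ?_).congr hU ?_⟩
    · filter_upwards [self_mem_nhdsWithin] with z hz
      have hz' : K ∈ 𝓝 z := mem_of_superset (hU.mem_nhds hz) hUK
      exact (hf.contDiffAt hz').differentiableAt (by simp)
    · exact (hf.fderivWithin hK (by simp)).clm_apply contDiffOn_const
    · filter_upwards [self_mem_nhdsWithin] with z hz
      have hz' : K ∈ 𝓝 z := mem_of_superset (hU.mem_nhds hz) hUK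
      simp only [dirDeriv]
      rw [fderivWithin_of_mem_nhds hz']

end HasJetLimits

/-! ### Remainder terms at the vertex of the triangle -/

/-- The interior `{(u, v) : 0 < v < u < 1}` of the triangle. -/
def openTriangle : Set (ℝ × ℝ) := {x | 0 < x.2 ∧ x.2 < x.1 ∧ x.1 < 1}

theorem isOpen_openTriangle : IsOpen openTriangle :=
  (isOpen_lt continuous_const continuous_snd).inter
    ((isOpen_lt continuous_snd continuous_fst).inter (isOpen_lt continuous_fst continuous_const))

theorem div_mem_Ioo_of_mem_openTriangle {z : ℝ × ℝ} (hz : z ∈ openTriangle) :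
    z.2 / z.1 ∈ Ioo (0 : ℝ) 1 := by
  obtain ⟨h1, h2, h3⟩ := hz
  exact ⟨div_pos h1 (h1.trans h2), (div_lt_one (h1.trans h2)).2 h2⟩

/-- Each derivative of `h(y/x) x^a` has the same form, with the power of `x` lowered by one and one
order of smoothness of `h` spent. As `j < a`, a positive power remains to the end, and `h` is
bounded on `[0,1]`. -/
theorem hasJetLimits_mul_pow {j a : ℕ} (hja : j < a) {h : ℝ → ℝ}
    (hh : ContDiffOn ℝ j h (Icc 0 1)) :
    HasJetLimits ⊥ openTriangle 0 j (fun z => h (z.2 / z.1) * z.1 ^ a) := by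
  have key : ∀ {a : ℕ} {h : ℝ → ℝ}, 0 < a → ContinuousOn h (Icc 0 1) →
      Tendsto (fun z : ℝ × ℝ => h (z.2 / z.1) * z.1 ^ a) (𝓝[openTriangle] 0) (𝓝 0) := by
    intro a h ha hh
    obtain ⟨M, hM⟩ := isCompact_Icc.exists_bound_of_continuousOn hh
    have h1 : Tendsto (fun z : ℝ × ℝ => z.1 ^ a) (𝓝[openTriangle] 0) (𝓝 0) := by
      have : Continuous fun z : ℝ × ℝ => z.1 ^ a := by fun_prop
      have := this.tendsto 0
      simp only [Prod.fst_zero, zero_pow ha.ne'] at this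
      exact this.mono_left nhdsWithin_le_nhds
    refine bdd_le_mul_tendsto_zero' M ?_ h1
    filter_upwards [self_mem_nhdsWithin] with z hz
    exact hM _ (Ioo_subset_Icc_self (div_mem_Ioo_of_mem_openTriangle hz))
  induction j generalizing a h with
  | zero => exact ⟨0, rfl, key hja hh.continuousOn⟩
  | succ j ih =>
    obtain ⟨a, rfl⟩ : ∃ b, a = b + 1 := ⟨a - 1, by omega⟩
    have hd : ∀ z ∈ openTriangle, HasFDerivAt (fun z : ℝ × ℝ => h (z.2 / z.1) * z.1 ^ (a + 1))
        (h (z.2 / z.1) • (((a + 1 : ℕ) * z.1 ^ a) • ContinuousLinearMap.fst ℝ ℝ ℝ)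
          + z.1 ^ (a + 1) • (derivWithin h (Icc 0 1) (z.2 / z.1) •
            (z.1⁻¹ • ContinuousLinearMap.snd ℝ ℝ ℝ
              - (z.2 / z.1 ^ 2) • ContinuousLinearMap.fst ℝ ℝ ℝ))) z := by
      intro z hz
      have hτ := div_mem_Ioo_of_mem_openTriangle hz
      have hx : z.1 ≠ 0 := (hz.1.trans hz.2.1).ne'
      have hnh : Icc (0 : ℝ) 1 ∈ 𝓝 (z.2 / z.1) := Icc_mem_nhds hτ.1 hτ.2
      have h1 : HasDerivAt h (derivWithin h (Icc 0 1) (z.2 / z.1)) (z.2 / z.1) := by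
        have := (hh.contDiffAt hnh).differentiableAt (by simp)
        rw [derivWithin_of_mem_nhds hnh]
        exact this.hasDerivAt
      have h2 : HasFDerivAt (fun z : ℝ × ℝ => z.2 / z.1) (z.1⁻¹ • ContinuousLinearMap.snd ℝ ℝ ℝ
          - (z.2 / z.1 ^ 2) • ContinuousLinearMap.fst ℝ ℝ ℝ) z := by
        have h2 := (hasFDerivAt_snd (𝕜 := ℝ) (p := z)).mul
          ((hasDerivAt_inv hx).comp_hasFDerivAt z (hasFDerivAt_fst (𝕜 := ℝ) (p := z)))
        refine h2.congr_fderiv ?_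
        ext <;> simp [div_eq_mul_inv]
      have h3 : HasFDerivAt (fun z : ℝ × ℝ => z.1 ^ (a + 1))
          (((a + 1 : ℕ) * z.1 ^ a) • ContinuousLinearMap.fst ℝ ℝ ℝ) z := by
        have := (hasDerivAt_pow (a + 1) z.1).comp_hasFDerivAt z (hasFDerivAt_fst (𝕜 := ℝ))
        exact this
      exact (h1.comp_hasFDerivAt z h2).mul h3
    refine ⟨⟨0, rfl, key (by omega) hh.continuousOn⟩, ?_, fun v => ?_⟩
    · filter_upwards [self_mem_nhdsWithin] with z hz using (hd z hz).differentiableAt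
    · have hh' : ContDiffOn ℝ j (derivWithin h (Icc 0 1)) (Icc 0 1) :=
        hh.derivWithin (uniqueDiffOn_Icc zero_lt_one) (by simp)
      have hh0 : ContDiffOn ℝ j h (Icc 0 1) := hh.of_le (by simp)
      -- The new profile is the derivative in the direction `v`, divided by `x^a` and written in `t
      -- = y/x`.
      refine (ih (a := a) (h := fun t => (a + 1 : ℕ) * v.1 * h t
        + (v.2 - v.1 * t) * derivWithin h (Icc 0 1) t) (by omega) ?_).congr
          isOpen_openTriangle ?_
      · exact (contDiffOn_const.mul hh0).add
          ((contDiffOn_const.sub (contDiffOn_const.mul contDiffOn_id)).mul hh')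
      · filter_upwards [self_mem_nhdsWithin] with z hz
        have hx : z.1 ≠ 0 := (hz.1.trans hz.2.1).ne'
        simp only [dirDeriv]
        rw [(hd z hz).fderiv]
        simp
        field_simp
        ring
-- Expansion of splines along the collapsed edge
section

open Polynomial

/-- Near the edge `{0} × [0,1]`, the function `f` is a polynomial in the first variable whose
coefficients are functions of class `C^k` of the second variable. -/
def HasEdgeExpansion (k : ℕ) (f : ℝ × ℝ → ℝ) (h : ℝ → ℝ[X]) : Prop :=
  (∃ n, ∀ t, (h t).natDegree < n) ∧ (∀ a, ContDiffOn ℝ k (fun t => (h t).coeff a) (Icc 0 1)) ∧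
    ∃ δ > 0, ∀ s ∈ Ico 0 δ, ∀ t ∈ Icc (0 : ℝ) 1, f (s, t) = (h t).eval s

namespace HasEdgeExpansion

variable {k : ℕ} {f g : ℝ × ℝ → ℝ} {h h' : ℝ → ℝ[X]}

theorem add (hf : HasEdgeExpansion k f h) (hg : HasEdgeExpansion k g h') :
    HasEdgeExpansion k (f + g) (fun t => h t + h' t) := by
  obtain ⟨⟨n, hn⟩, hc, δ, hδ, he⟩ := hf
  obtain ⟨⟨n', hn'⟩, hc', δ', hδ', he'⟩ := hg
  refine ⟨⟨max n n', fun t => ?_⟩, fun a => ?_, min δ δ', lt_min hδ hδ', fun s hs t ht => ?_⟩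
  · exact (natDegree_add_le _ _).trans_lt (max_lt_max (hn t) (hn' t))
  · simpa using (hc a).add (hc' a)
  · simp [he s ⟨hs.1, hs.2.trans_le (min_le_left _ _)⟩ t ht,
      he' s ⟨hs.1, hs.2.trans_le (min_le_right _ _)⟩ t ht]

theorem mul (hf : HasEdgeExpansion k f h) (hg : HasEdgeExpansion k g h') :
    HasEdgeExpansion k (f * g) (fun t => h t * h' t) := by
  obtain ⟨⟨n, hn⟩, hc, δ, hδ, he⟩ := hf
  obtain ⟨⟨n', hn'⟩, hc', δ', hδ', he'⟩ := hg
  refine ⟨⟨n + n', fun t => ?_⟩, fun a => ?_, min δ δ', lt_min hδ hδ', fun s hs t ht => ?_⟩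
  · exact natDegree_mul_le.trans_lt (add_lt_add (hn t) (hn' t))
  · simp only [coeff_mul]
    exact ContDiffOn.sum fun i _ => (hc i.1).mul (hc' i.2)
  · simp [he s ⟨hs.1, hs.2.trans_le (min_le_left _ _)⟩ t ht,
      he' s ⟨hs.1, hs.2.trans_le (min_le_right _ _)⟩ t ht]

theorem of_polynomial {φ : ℝ → ℝ} {P : ℝ[X]} {δ : ℝ} (hδ : 0 < δ)
    (h : ∀ s ∈ Ico 0 δ, φ s = P.eval s) :
    HasEdgeExpansion k (fun x => φ x.1) (fun _ => P) :=
  ⟨⟨P.natDegree + 1, fun _ => Nat.lt_succ_self _⟩, fun _ => contDiffOn_const, δ, hδ,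
    fun s hs _ _ => h s hs⟩

theorem of_contDiffOn {ψ : ℝ → ℝ} (hψ : ContDiffOn ℝ k ψ (Icc 0 1)) :
    HasEdgeExpansion k (fun x => ψ x.2) (fun t => C (ψ t)) := by
  refine ⟨⟨1, fun t => by simp⟩, fun a => ?_, 1, one_pos, fun s _ t _ => by simp⟩
  simp only [coeff_C]
  split_ifs
  · exact hψ
  · exact contDiffOn_const

theorem congr (hf : HasEdgeExpansion k f h) (hfg : f = g) : HasEdgeExpansion k g h := hfg ▸ hf

theorem boxDeriv_eq (hf : HasEdgeExpansion k f h) (a : ℕ) {t : ℝ} (ht : t ∈ Icc (0 : ℝ) 1) :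
    boxDeriv a 0 f (0, t) = (a.factorial : ℝ) * (h t).coeff a := by
  obtain ⟨-, -, δ, hδ, he⟩ := hf
  have h1 : (fun s => f (s, t)) =ᶠ[𝓝[Icc 0 1] 0] fun s => (h t).eval s := by
    have : Iio δ ∈ 𝓝[Icc 0 1] (0 : ℝ) := mem_nhdsWithin_of_mem_nhds (Iio_mem_nhds hδ)
    filter_upwards [this, self_mem_nhdsWithin] with s hs hs'
    exact he s ⟨hs'.1, hs⟩ t ht
  have h2 : iteratedDeriv a (fun s => (h t).eval s) = fun s => (derivative^[a] (h t)).eval s := by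
    induction a with
    | zero => simp
    | succ a ih =>
      rw [iteratedDeriv_succ, ih]
      ext s
      rw [Polynomial.deriv, Function.iterate_succ_apply']
  simp only [boxDeriv, iteratedDerivWithin_zero]
  rw [h1.iteratedDerivWithin_eq (he 0 ⟨le_rfl, hδ⟩ t ht),
    iteratedDerivWithin_eq_iteratedDeriv (uniqueDiffOn_Icc zero_lt_one)
      (by simpa using ((h t).contDiff_aeval (𝕜 := ℝ) (R := ℝ) a).contDiffAt) ⟨le_rfl, zero_le_one⟩, h2]
  show (derivative^[a] (h t)).eval 0 = _
  rw [← coeff_zero_eq_eval_zero, coeff_iterate_derivative]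
  simp [Nat.descFactorial_self]

end HasEdgeExpansion

/-- A monomial `x^i y^j` pulls back to `s^(i+j) t^j`. -/
theorem exists_hasEdgeExpansion_polyFun (k : ℕ) (ϱ : MvPolynomial (Fin 2) ℝ) :
    ∃ h, HasEdgeExpansion k (polyFun ϱ ∘ collapse) h := by
  induction ϱ using MvPolynomial.induction_on with
  | C a => exact ⟨_, (HasEdgeExpansion.of_contDiffOn (ψ := fun _ => a) contDiffOn_const).congr
      (by ext; simp [polyFun])⟩
  | add p q hp hq =>
    obtain ⟨h, hp⟩ := hp
    obtain ⟨h', hq⟩ := hq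
    exact ⟨_, (hp.add hq).congr (by ext; simp [polyFun])⟩
  | mul_X p i hp =>
    obtain ⟨h, hp⟩ := hp
    have hX : HasEdgeExpansion k (fun x => x.1) (fun _ => X) :=
      HasEdgeExpansion.of_polynomial (φ := fun s => s) one_pos (by simp)
    fin_cases i
    · exact ⟨_, (hp.mul hX).congr (by ext; simp [polyFun, collapse])⟩
    · exact ⟨_, (hp.mul (hX.mul (HasEdgeExpansion.of_contDiffOn contDiffOn_id))).congr
        (by ext; simp [polyFun, collapse])⟩

namespace OpenKnotVector

variable {p N : ℕ} (S : OpenKnotVector p N)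

theorem knot_zero : S.knot 0 = 0 := S.knot_eq_zero 0 (by omega) le_rfl

theorem knot_one_le {i : ℤ} (hi : 1 ≤ i) (hi' : i ≤ N + p + 1) : S.knot 1 ≤ S.knot i := by
  have key : ∀ m : ℕ, m + 1 ≤ N → S.knot 1 ≤ S.knot (m + 1) := by
    intro m
    induction m with
    | zero => intro; simp
    | succ m ih =>
      intro hm
      refine (ih (by omega)).trans ?_
      have := S.knot_le (m + 1) (by omega) (by omega)
      simpa using this
  have hone : S.knot 1 ≤ 1 := by
    have hN := S.knot_eq_one (N + 1) le_rfl (by omega)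
    rcases Nat.eq_zero_or_pos N with h0 | h0
    · subst h0
      simpa using hN.le
    · have h1 := key (N - 1) (by omega)
      have h2 : (((N - 1 : ℕ) : ℤ) + 1) = N := by omega
      rw [h2] at h1
      exact h1.trans (S.last_lt.le.trans hN.le)
  rcases le_or_gt i N with h | h
  · have h1 := key (i - 1).toNat (by omega)
    have h2 : ((i - 1).toNat : ℤ) + 1 = i := by omega
    rwa [h2] at h1
  · rw [S.knot_eq_one i (by omega) hi']
    exact hone

theorem knot_one_le_one : S.knot 1 ≤ 1 := by
  have := S.knot_one_le (i := N + 1) (by omega) (by omega)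
  rwa [S.knot_eq_one (N + 1) le_rfl (by omega)] at this

theorem knot_one_pos : 0 < S.knot 1 := S.knot_zero ▸ S.first_lt

/-- No knot lies inside `(0, s_1)`, so the degree-zero functions are constant there, and the
recursion preserves polynomials. The index bounds keep every knot that occurs inside the knot
vector; vanishing denominators are harmless since `0⁻¹ = 0`. -/
theorem exists_polynomial_bspline (d : ℕ) (i : ℤ) (hi : -(p : ℤ) ≤ i - d) (hi' : i ≤ N + p) :
    ∃ P : ℝ[X], ∀ x ∈ Ico 0 (S.knot 1), bspline S.knot d i x = P.eval x := by
  induction d generalizing i with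
  | zero =>
    refine ⟨if i = 0 then 1 else 0, fun x hx => ?_⟩
    have hx1 : x ≠ 1 := (hx.2.trans_le S.knot_one_le_one).ne
    have hiff : (S.knot i ≤ x ∧ x < S.knot (i + 1)) ↔ i = 0 := by
      constructor
      · rintro ⟨h1, h2⟩
        rcases lt_trichotomy i 0 with h | h | h
        · rw [S.knot_eq_zero (i + 1) (by omega) (by omega)] at h2
          exact absurd hx.1 (not_le.2 h2)
        · exact h
        · exact absurd hx.2 (not_lt.2 ((S.knot_one_le (by omega) (by omega)).trans h1))
      · rintro rfl
        exact ⟨S.knot_zero ▸ hx.1, by simpa using hx.2⟩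
    simp only [bspline, hiff, hx1, and_false, or_false]
    split_ifs <;> simp
  | succ d ih =>
    obtain ⟨P, hP⟩ := ih (i - 1) (by push_cast at hi ⊢; omega) (by omega)
    obtain ⟨Q, hQ⟩ := ih i (by push_cast at hi ⊢; omega) hi'
    refine ⟨(X - C (S.knot (i - (d + 1)))) * C (S.knot i - S.knot (i - (d + 1)))⁻¹ * P
      + (C (S.knot (i + 1)) - X) * C (S.knot (i + 1) - S.knot (i - d))⁻¹ * Q, fun x hx => ?_⟩
    simp only [bspline, hP x hx, hQ x hx]
    simp [div_eq_mul_inv]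

/-- Restricting a product with first index `0` to `s = 0` thus isolates its factor in `t`. -/
theorem bspline_zero_zero (d : ℕ) (hd : d ≤ p) : bspline S.knot d 0 0 = 1 := by
  induction d with
  | zero =>
    have h1 := S.knot_zero
    have h2 := S.knot_one_pos
    simp [bspline, h1, h2]
  | succ d ih =>
    have h2 := S.knot_one_pos.ne'
    rw [bspline, ih (by omega), S.knot_eq_zero (0 - (d + 1)) (by omega) (by omega),
      S.knot_eq_zero (0 - d) (by omega) (by omega), S.knot_zero]
    simp [h2]

end OpenKnotVector

theorem exists_hasEdgeExpansion_spline {p q N₁ N₂ k : ℕ} (S : OpenKnotVector p N₁)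
    (T : OpenKnotVector q N₂) (hS : ∀ f ∈ splineSpace S T, ContDiffOn ℝ k f box)
    {f : ℝ × ℝ → ℝ} (hf : f ∈ splineSpace S T) : ∃ h, HasEdgeExpansion k f h := by
  induction hf using Submodule.span_induction with
  | mem f hf =>
    obtain ⟨i, j, hi, hj, rfl⟩ := hf
    obtain ⟨P, hP⟩ := S.exists_polynomial_bspline p i (by omega) (by omega)
    refine ⟨_, ((HasEdgeExpansion.of_polynomial S.knot_one_pos hP).mul
      (HasEdgeExpansion.of_contDiffOn ?_))⟩
    -- The `C^k` assumption concerns tensor products only; smoothness of the factor in `t` is read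
    -- off from the product with `i = 0` on the edge `s = 0`.
    have h0 := hS _ (Submodule.subset_span ⟨0, j, by omega, hj, rfl⟩)
    have h1 : ContDiffOn ℝ k (fun t : ℝ => ((0 : ℝ), t)) (Icc 0 1) := by fun_prop
    have h2 := h0.comp h1 (fun t ht => ⟨⟨le_rfl, zero_le_one⟩, ht⟩)
    refine h2.congr fun t _ => ?_
    have := S.bspline_zero_zero p le_rfl
    simp [this]
  | zero => exact ⟨_, (HasEdgeExpansion.of_contDiffOn (ψ := fun _ => 0) contDiffOn_const).congr rfl⟩
  | add f g _ _ hf hg =>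
    obtain ⟨h, hf⟩ := hf
    obtain ⟨h', hg⟩ := hg
    exact ⟨_, hf.add hg⟩
  | smul c f _ hf =>
    obtain ⟨h, hf⟩ := hf
    exact ⟨_, ((HasEdgeExpansion.of_contDiffOn (ψ := fun _ => c) contDiffOn_const).mul hf).congr
      rfl⟩

end

/-! ### Pulling back to the triangle -/

/-- The inverse `(u, v) ↦ (u, v / u)` of the map `collapse` away from the collapsed edge. -/
noncomputable def uncollapse (z : ℝ × ℝ) : ℝ × ℝ := (z.1, z.2 / z.1)

theorem mapsTo_uncollapse_openTriangle : MapsTo uncollapse openTriangle openBox := fun _ hz =>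
  ⟨⟨hz.1.trans hz.2.1, hz.2.2⟩, div_mem_Ioo_of_mem_openTriangle hz⟩

theorem collapse_uncollapse {z : ℝ × ℝ} (hz : z.1 ≠ 0) : collapse (uncollapse z) = z := by
  ext
  · rfl
  · simp [collapse, uncollapse, mul_div_cancel₀ _ hz]

theorem uncollapse_collapse {z : ℝ × ℝ} (hz : z.1 ≠ 0) : uncollapse (collapse z) = z := by
  ext
  · rfl
  · simp [collapse, uncollapse, mul_div_cancel_left₀ _ hz]

theorem mapsTo_collapse_openBox : MapsTo collapse openBox openTriangle := fun _ hz =>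
  ⟨mul_pos hz.1.1 hz.2.1, mul_lt_of_lt_one_right hz.1.1 hz.2.2, hz.1.2⟩

theorem contDiff_polyFun (n : WithTop ℕ∞) (ϱ : MvPolynomial (Fin 2) ℝ) :
    ContDiff ℝ n (polyFun ϱ) := by
  induction ϱ using MvPolynomial.induction_on with
  | C a =>
    have : polyFun (MvPolynomial.C a) = fun _ => a := by
      ext
      simp [polyFun]
    rw [this]
    exact contDiff_const
  | add p q hp hq =>
    have : polyFun (p + q) = fun z => polyFun p z + polyFun q z := by
      ext
      simp [polyFun]
    rw [this]
    exact hp.add hq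
  | mul_X p i hp =>
    have h : polyFun (p * MvPolynomial.X i) = fun z => polyFun p z * (![z.1, z.2] : Fin 2 → ℝ) i := by
      ext
      simp [polyFun]
    rw [h]
    fin_cases i
    · exact hp.mul contDiff_fst
    · exact hp.mul contDiff_snd

/-- Pulled back to the triangle, a function equivalent to a polynomial agrees with this polynomial
at the collapsed vertex up to a remainder all of whose derivatives of order at most `k` tend to `0`.
-/
theorem hasJetLimits_remainder {k : ℕ} {f : ℝ × ℝ → ℝ} {h : ℝ → Polynomial ℝ}
    (hf : HasEdgeExpansion k f h) {ϱ : MvPolynomial (Fin 2) ℝ} (hϱ : EquivAtEdge k f ϱ) :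
    HasJetLimits ⊥ openTriangle 0 k (fun z => f (uncollapse z) - polyFun ϱ z) := by
  obtain ⟨h', hf'⟩ := exists_hasEdgeExpansion_polyFun k ϱ
  have hcoeff : ∀ a ≤ k, ∀ t ∈ Icc (0 : ℝ) 1, (h t).coeff a = (h' t).coeff a := by
    intro a ha t ht
    -- The pure `s`-derivatives at the edge are the coefficients of `s^a` up to the factor `a!`.
    have h1 := hϱ a 0 ha (Nat.zero_le _) (0, t) ⟨rfl, ht⟩
    rw [hf.boxDeriv_eq a ht, hf'.boxDeriv_eq a ht] at h1
    exact mul_left_cancel₀ (by positivity) h1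
  obtain ⟨⟨n, hn⟩, hc, δ, hδ, he⟩ := hf
  obtain ⟨⟨n', hn'⟩, hc', δ', hδ', he'⟩ := hf'
  have hsum : HasJetLimits ⊥ openTriangle 0 k (fun z => ∑ a ∈ Finset.range (max n n'),
      ((h (z.2 / z.1)).coeff a - (h' (z.2 / z.1)).coeff a) * z.1 ^ a) := by
    refine HasJetLimits.sum isOpen_openTriangle _ fun a _ => ?_
    rcases le_or_gt a k with hak | hak
    · refine HasJetLimits.zero.congr isOpen_openTriangle ?_
      filter_upwards [self_mem_nhdsWithin] with z hz
      rw [hcoeff a hak _ (Ioo_subset_Icc_self (div_mem_Ioo_of_mem_openTriangle hz)), sub_self,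
        zero_mul]
    · exact hasJetLimits_mul_pow (h := fun t => (h t).coeff a - (h' t).coeff a) hak
        ((hc a).sub (hc' a))
  refine hsum.congr isOpen_openTriangle ?_
  have hnear : ∀ᶠ z : ℝ × ℝ in 𝓝[openTriangle] 0, z.1 < min δ δ' :=
    mem_nhdsWithin_of_mem_nhds
      ((isOpen_lt continuous_fst continuous_const).mem_nhds (lt_min hδ hδ'))
  filter_upwards [self_mem_nhdsWithin, hnear] with z hz hzδ
  have hτ := Ioo_subset_Icc_self (div_mem_Ioo_of_mem_openTriangle hz)
  have hx : 0 < z.1 := hz.1.trans hz.2.1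
  have h1 := he z.1 ⟨hx.le, hzδ.trans_le (min_le_left _ _)⟩ _ hτ
  have h2 := he' z.1 ⟨hx.le, hzδ.trans_le (min_le_right _ _)⟩ _ hτ
  have h3 : (polyFun ϱ ∘ collapse) (z.1, z.2 / z.1) = polyFun ϱ z :=
    congrArg (polyFun ϱ) (collapse_uncollapse hx.ne')
  rw [h3] at h2
  rw [show f (uncollapse z) = f (z.1, z.2 / z.1) from rfl, h1, h2,
    Polynomial.eval_eq_sum_range' ((hn _).trans_le (le_max_left n n')),
    Polynomial.eval_eq_sum_range' ((hn' _).trans_le (le_max_right n n')), ← Finset.sum_sub_distrib]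
  exact Finset.sum_congr rfl fun a _ => by ring

/-! ### Limits of the Jacobian determinant -/

/-- The Jacobian determinant of the map with components `F` and `G`. -/
noncomputable def jacobian (F G : ℝ × ℝ → ℝ) (z : ℝ × ℝ) : ℝ :=
  dirDeriv (1, 0) F z * dirDeriv (0, 1) G z - dirDeriv (0, 1) F z * dirDeriv (1, 0) G z

theorem det_eq (A : ℝ × ℝ →L[ℝ] ℝ × ℝ) :
    A.det = (A (1, 0)).1 * (A (0, 1)).2 - (A (0, 1)).1 * (A (1, 0)).2 := by
  rw [ContinuousLinearMap.det, ← LinearMap.det_toMatrix (Module.Basis.finTwoProd ℝ),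
    Matrix.det_fin_two]
  simp [LinearMap.toMatrix_apply]

theorem det_fderiv_prodMk {F G : ℝ × ℝ → ℝ} {z : ℝ × ℝ} (hF : DifferentiableAt ℝ F z)
    (hG : DifferentiableAt ℝ G z) :
    (fderiv ℝ (fun z => (F z, G z)) z).det = jacobian F G z := by
  rw [DifferentiableAt.fderiv_prodMk hF hG, det_eq]
  rfl

theorem dirDeriv_div {F G : ℝ × ℝ → ℝ} {z : ℝ × ℝ} (hF : DifferentiableAt ℝ F z)
    (hG : DifferentiableAt ℝ G z) (h0 : G z ≠ 0) (v : ℝ × ℝ) :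
    dirDeriv v (fun z => F z / G z) z
      = (dirDeriv v F z * G z - F z * dirDeriv v G z) / G z ^ 2 := by
  have h := hF.hasFDerivAt.mul ((hasDerivAt_inv h0).comp_hasFDerivAt z hG.hasFDerivAt)
  have h' : fderiv ℝ (fun z => F z / G z) z = _ := h.fderiv
  simp only [dirDeriv]
  rw [h']
  simp
  field_simp
  ring

theorem tendsto_dirDeriv_div {l : Filter (ℝ × ℝ)} {F G F₀ G₀ : ℝ × ℝ → ℝ} {x : ℝ × ℝ}
    (hF : ∀ᶠ z in l, DifferentiableAt ℝ F z) (hG : ∀ᶠ z in l, DifferentiableAt ℝ G z)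
    (hF₀ : DifferentiableAt ℝ F₀ x) (hG₀ : DifferentiableAt ℝ G₀ x) (h0 : G₀ x ≠ 0)
    (hFl : Tendsto F l (𝓝 (F₀ x))) (hGl : Tendsto G l (𝓝 (G₀ x)))
    (hFd : ∀ v, Tendsto (dirDeriv v F) l (𝓝 (dirDeriv v F₀ x)))
    (hGd : ∀ v, Tendsto (dirDeriv v G) l (𝓝 (dirDeriv v G₀ x))) (v : ℝ × ℝ) :
    Tendsto (dirDeriv v fun z => F z / G z) l (𝓝 (dirDeriv v (fun z => F₀ z / G₀ z) x)) := by
  rw [dirDeriv_div hF₀ hG₀ h0]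
  refine ((((hFd v).mul hGl).sub (hFl.mul (hGd v))).div (hGl.pow 2) (pow_ne_zero 2 h0)).congr' ?_
  filter_upwards [hF, hG, hGl.eventually_ne h0] with z h1 h2 h3
  exact (dirDeriv_div h1 h2 h3 v).symm

theorem HasJetLimits.of_remainder {k : ℕ} {f : ℝ × ℝ → ℝ} {ϱ : MvPolynomial (Fin 2) ℝ}
    (h : HasJetLimits ⊥ openTriangle 0 k (fun z => f z - polyFun ϱ z)) :
    HasJetLimits ⊤ openTriangle 0 k f := by
  have h1 : HasJetLimits ⊤ openTriangle 0 k (polyFun ϱ) :=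
    HasJetLimits.of_contDiffOn isOpen_openTriangle (subset_univ _) uniqueDiffOn_univ (mem_univ _)
      (contDiff_polyFun _ ϱ).contDiffOn
  exact (h1.add isOpen_openTriangle (h.mono_subgroup bot_le)).congr isOpen_openTriangle
    (Eventually.of_forall fun z => by ring)

theorem tendsto_of_remainder {k : ℕ} {f : ℝ × ℝ → ℝ} {ϱ : MvPolynomial (Fin 2) ℝ}
    (h : HasJetLimits ⊥ openTriangle 0 k (fun z => f z - polyFun ϱ z)) :
    Tendsto f (𝓝[openTriangle] 0) (𝓝 (polyFun ϱ 0)) := by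
  obtain ⟨c, hc, h1⟩ := h.tendsto
  obtain rfl : c = 0 := hc
  have h2 := ((contDiff_polyFun 0 ϱ).continuous.tendsto 0).mono_left
    (nhdsWithin_le_nhds (s := openTriangle))
  simpa using! h1.add h2

theorem tendsto_dirDeriv_of_remainder {k : ℕ} {f : ℝ × ℝ → ℝ} {ϱ : MvPolynomial (Fin 2) ℝ}
    (h : HasJetLimits ⊥ openTriangle 0 (k + 1) (fun z => f z - polyFun ϱ z)) (v : ℝ × ℝ) :
    Tendsto (dirDeriv v f) (𝓝[openTriangle] 0) (𝓝 (dirDeriv v (polyFun ϱ) 0)) := by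
  obtain ⟨c, hc, h1⟩ := (h.2.2 v).tendsto
  obtain rfl : c = 0 := hc
  have hϱ : Differentiable ℝ (polyFun ϱ) := (contDiff_polyFun 1 ϱ).differentiable one_ne_zero
  have hcont : Continuous (dirDeriv v (polyFun ϱ)) :=
    ((contDiff_polyFun 1 ϱ).continuous_fderiv one_ne_zero).clm_apply continuous_const
  have h2 := (hcont.tendsto 0).mono_left (nhdsWithin_le_nhds (s := openTriangle))
  have h3 := h1.add h2
  rw [zero_add] at h3
  refine h3.congr' ?_
  filter_upwards [h.of_remainder.2.1] with z hz
  simp only [dirDeriv]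
  rw [fderiv_fun_sub hz (hϱ z)]
  simp

theorem uniqueDiffOn_triangle : UniqueDiffOn ℝ triangle := by
  refine uniqueDiffOn_convex ?_ ?_
  · rintro x ⟨h1, h2, h3, h4⟩ y ⟨h5, h6, h7, h8⟩ a b ha hb hab
    simp only [triangle, mem_ofPred_eq, Prod.fst_add, Prod.smul_fst, smul_eq_mul, Prod.snd_add,
      Prod.smul_snd]
    refine ⟨by positivity, ?_, by positivity, by gcongr⟩
    calc a * x.1 + b * y.1 ≤ a * 1 + b * 1 := by gcongr
      _ = 1 := by rw [mul_one, mul_one, hab]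
  · have h : openTriangle ⊆ triangle := fun z hz =>
      ⟨(hz.1.trans hz.2.1).le, hz.2.2.le, hz.1.le, hz.2.1.le⟩
    exact ⟨(1 / 2, 1 / 4), interior_maximal h isOpen_openTriangle
      ⟨by norm_num, by norm_num, by norm_num⟩⟩

/-- At the collapsed vertex, the Jacobian determinant of the pulled back rational map tends to the
Jacobian determinant of the rational triangular patch. -/
theorem tendsto_jacobian_zero {k : ℕ} {N : Fin 3 → ℝ × ℝ → ℝ} {ϱ : Fin 3 → MvPolynomial (Fin 2) ℝ}
    (h : ∀ i, HasJetLimits ⊥ openTriangle 0 (k + 1) (fun z => N i z - polyFun (ϱ i) z))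
    (h0 : polyFun (ϱ 0) 0 ≠ 0) :
    Tendsto (jacobian (fun z => N 1 z / N 0 z) (fun z => N 2 z / N 0 z)) (𝓝[openTriangle] 0)
      (𝓝 (fderivWithin ℝ (ratMap fun i => polyFun (ϱ i)) triangle 0).det) := by
  have hd : ∀ i, DifferentiableAt ℝ (polyFun (ϱ i)) 0 := fun i =>
    (contDiff_polyFun 1 (ϱ i)).differentiable one_ne_zero 0
  have hdiv : ∀ i, DifferentiableAt ℝ (fun z => polyFun (ϱ i) z / polyFun (ϱ 0) z) 0 :=
    fun i => by
    simp only [div_eq_mul_inv]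
    exact (hd i).mul ((hd 0).inv h0)
  have hrat : fderivWithin ℝ (ratMap fun i => polyFun (ϱ i)) triangle 0
      = fderiv ℝ (fun z => (polyFun (ϱ 1) z / polyFun (ϱ 0) z, polyFun (ϱ 2) z / polyFun (ϱ 0) z))
        0 :=
    fderivWithin_eq_fderiv (uniqueDiffOn_triangle 0 ⟨le_rfl, zero_le_one, le_rfl, le_rfl⟩)
      ((hdiv 1).prodMk (hdiv 2))
  rw [hrat, det_fderiv_prodMk (hdiv 1) (hdiv 2)]
  have key : ∀ i v, _ := fun i v => tendsto_dirDeriv_div (h i).of_remainder.2.1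
    (h 0).of_remainder.2.1 (hd i) (hd 0) h0 (tendsto_of_remainder (h i))
    (tendsto_of_remainder (h 0)) (tendsto_dirDeriv_of_remainder (h i))
    (tendsto_dirDeriv_of_remainder (h 0)) v
  exact ((key 1 _).mul (key 2 _)).sub ((key 1 _).mul (key 2 _))

theorem isOpen_openBox : IsOpen openBox := isOpen_Ioo.prod isOpen_Ioo

theorem openBox_subset_box : openBox ⊆ box :=
  prod_mono Ioo_subset_Icc_self Ioo_subset_Icc_self

/-- The triangle without the vertex at the origin. -/
def puncturedTriangle : Set (ℝ × ℝ) := triangle ∩ {x | 0 < x.1}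

theorem uniqueDiffOn_puncturedTriangle : UniqueDiffOn ℝ puncturedTriangle :=
  uniqueDiffOn_triangle.inter (isOpen_lt continuous_const continuous_fst)

theorem openTriangle_subset_puncturedTriangle : openTriangle ⊆ puncturedTriangle := fun _ hz =>
  have h := hz.1.trans hz.2.1
  ⟨⟨h.le, hz.2.2.le, hz.1.le, hz.2.1.le⟩, h⟩

theorem mapsTo_uncollapse_puncturedTriangle :
    MapsTo uncollapse puncturedTriangle (Ioc 0 1 ×ˢ Icc 0 1) := fun _ hz =>
  ⟨⟨hz.2, hz.1.2.1⟩, div_nonneg hz.1.2.2.1 hz.1.1, div_le_one_of_le₀ hz.1.2.2.2 hz.1.1⟩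

theorem mapsTo_uncollapse_box : MapsTo uncollapse puncturedTriangle box := fun _ hz =>
  have h := mapsTo_uncollapse_puncturedTriangle hz
  ⟨Ioc_subset_Icc_self h.1, h.2⟩

theorem contDiffOn_uncollapse (n : WithTop ℕ∞) : ContDiffOn ℝ n uncollapse puncturedTriangle :=
  contDiffOn_fst.prodMk (contDiffOn_snd.div contDiffOn_fst fun _ hz => (ne_of_gt hz.2))

/-- Since `collapse ∘ uncollapse` is the identity here, the two determinants have product `1`. -/
theorem det_fderivWithin_uncollapse_ne_zero {z : ℝ × ℝ} (hz : z ∈ puncturedTriangle) :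
    (fderivWithin ℝ uncollapse puncturedTriangle z).det ≠ 0 := by
  have hu := uniqueDiffOn_puncturedTriangle z hz
  have hv : DifferentiableWithinAt ℝ uncollapse puncturedTriangle z :=
    (contDiffOn_uncollapse 1).differentiableOn one_ne_zero z hz
  have hc : Differentiable ℝ collapse :=
    differentiable_fst.prodMk (differentiable_fst.mul differentiable_snd)
  have h1 : HasFDerivWithinAt (collapse ∘ uncollapse)
      ((fderiv ℝ collapse (uncollapse z)).comp (fderivWithin ℝ uncollapse puncturedTriangle z))
      puncturedTriangle z := (hc _).hasFDerivAt.comp_hasFDerivWithinAt z hv.hasFDerivWithinAt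
  have h2 : HasFDerivWithinAt (collapse ∘ uncollapse) (ContinuousLinearMap.id ℝ (ℝ × ℝ))
      puncturedTriangle z :=
    (hasFDerivWithinAt_id z _).congr (fun w hw => collapse_uncollapse hw.2.ne')
      (collapse_uncollapse hz.2.ne')
  have h3 := hu.eq h1 h2
  have h4 : (fderiv ℝ collapse (uncollapse z)).det
      * (fderivWithin ℝ uncollapse puncturedTriangle z).det = 1 := by
    have := congrArg ContinuousLinearMap.det h3
    simp only [ContinuousLinearMap.det, ContinuousLinearMap.toLinearMap_comp,
      LinearMap.det_comp] at this
    rw [ContinuousLinearMap.det, ContinuousLinearMap.det, this]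
    simp
  exact right_ne_zero_of_mul_eq_one h4

theorem contDiffOn_ratMap {k : ℕ} {g : Fin 3 → ℝ × ℝ → ℝ} (hg : ∀ i, ContDiffOn ℝ k (g i) box)
    (h0 : ∀ x ∈ box, g 0 x ≠ 0) : ContDiffOn ℝ k (ratMap g) box :=
  ((hg 1).div (hg 0) h0).prodMk ((hg 2).div (hg 0) h0)

theorem jacobian_eq_det_fderiv {H : ℝ × ℝ → ℝ × ℝ} {z : ℝ × ℝ} (h : DifferentiableAt ℝ H z) :
    jacobian (fun w => (H w).1) (fun w => (H w).2) z = (fderiv ℝ H z).det :=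
  (det_fderiv_prodMk h.fst h.snd).symm

theorem tendsto_jacobian_of_mem_puncturedTriangle {k : ℕ} (hk : k ≠ 0) {H : ℝ × ℝ → ℝ × ℝ}
    (hH : ContDiffOn ℝ k H box) {z : ℝ × ℝ} (hz : z ∈ puncturedTriangle)
    (hdet : (fderivWithin ℝ H box (uncollapse z)).det ≠ 0) :
    ∃ c ≠ 0, Tendsto (jacobian (fun w => (H (uncollapse w)).1) (fun w => (H (uncollapse w)).2))
      (𝓝[openTriangle] z) (𝓝 c) := by
  have hk' : (k : WithTop ℕ∞) ≠ 0 := by exact_mod_cast hk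
  have hcomp : ContDiffOn ℝ k (H ∘ uncollapse) puncturedTriangle :=
    hH.comp (contDiffOn_uncollapse k) mapsTo_uncollapse_box
  have hu := uniqueDiffOn_puncturedTriangle
  refine ⟨(fderivWithin ℝ (H ∘ uncollapse) puncturedTriangle z).det, ?_, ?_⟩
  · rw [fderivWithin_comp z (hH.differentiableOn hk' _ (mapsTo_uncollapse_box hz))
      ((contDiffOn_uncollapse k).differentiableOn hk' z hz) mapsTo_uncollapse_box (hu z hz)]
    have h2 := det_fderivWithin_uncollapse_ne_zero hz
    simp only [ContinuousLinearMap.det, ContinuousLinearMap.toLinearMap_comp,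
      LinearMap.det_comp] at hdet h2 ⊢
    exact mul_ne_zero hdet h2
  -- The derivative within the punctured triangle is continuous up to its boundary points and is the
  -- ordinary one on the open triangle.
  · have hcont := (hcomp.continuousOn_fderivWithin hu (by exact_mod_cast Nat.one_le_iff_ne_zero.2 hk)
      : ContinuousOn _ puncturedTriangle)
    have h1 := (ContinuousLinearMap.continuous_det.tendsto _).comp
      ((hcont z hz).mono_left (nhdsWithin_mono z openTriangle_subset_puncturedTriangle))
    refine h1.congr' ?_
    filter_upwards [self_mem_nhdsWithin] with w hw
    have hw' : puncturedTriangle ∈ 𝓝 w :=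
      mem_of_superset (isOpen_openTriangle.mem_nhds hw) openTriangle_subset_puncturedTriangle
    rw [Function.comp_apply, fderivWithin_of_mem_nhds hw']
    exact (jacobian_eq_det_fderiv ((hcomp.contDiffAt hw').differentiableAt hk')).symm

/-! ### Inverse map and derivatives through it -/

theorem isOpen_image_and_contDiffOn_invFunOn {G : ℝ × ℝ → ℝ × ℝ} {U : Set (ℝ × ℝ)} {k : ℕ}
    (hk : k ≠ 0) (hU : IsOpen U) (hG : ContDiffOn ℝ k G U) (hinj : InjOn G U)
    (hdet : ∀ z ∈ U, (fderiv ℝ G z).det ≠ 0) :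
    IsOpen (G '' U) ∧ ContDiffOn ℝ k (Function.invFunOn G U) (G '' U) := by
  have hk' : (k : WithTop ℕ∞) ≠ 0 := by exact_mod_cast hk
  have key : ∀ z ∈ U, G '' U ∈ 𝓝 (G z) ∧ ContDiffAt ℝ k (Function.invFunOn G U) (G z) := by
    intro z hz
    have h1 : ContDiffAt ℝ k G z := hG.contDiffAt (hU.mem_nhds hz)
    have h2 : HasFDerivAt G
        (((fderiv ℝ G z).toContinuousLinearEquivOfDetNeZero (hdet z hz) :
          (ℝ × ℝ) ≃L[ℝ] (ℝ × ℝ)) : ℝ × ℝ →L[ℝ] ℝ × ℝ) z := by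
      rw [ContinuousLinearMap.coe_toContinuousLinearEquivOfDetNeZero]
      exact (h1.differentiableAt hk').hasFDerivAt
    have hs := h1.hasStrictFDerivAt' h2 hk'
    have hmap := hs.map_nhds_eq_of_equiv
    refine ⟨hmap ▸ image_mem_map (hU.mem_nhds hz), ?_⟩
    have hloc : ContDiffAt ℝ k (hs.localInverse G _ z) (G z) := h1.to_localInverse h2 hk'
    refine hloc.congr_of_eventuallyEq ?_
    have hmem : ∀ᶠ y in 𝓝 (G z), hs.localInverse G _ z y ∈ U := by
      refine hloc.continuousAt.eventually_mem ?_
      rw [hs.localInverse_apply_image]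
      exact hU.mem_nhds hz
    filter_upwards [hmem, hs.eventually_right_inverse] with y hy hy'
    -- By injectivity, a local inverse with values in `U` coincides with the global one.
    have h3 := hinj.leftInvOn_invFunOn hy
    rwa [hy'] at h3
  constructor
  · rw [isOpen_iff_mem_nhds]
    rintro _ ⟨z, hz, rfl⟩
    exact (key z hz).1
  · rintro _ ⟨z, hz, rfl⟩
    exact (key z hz).2.contDiffWithinAt

/-- Cramer's rule for the linear system that the chain rule gives for the two partial derivatives of
`χ`. -/
theorem dirDeriv_mul_jacobian {F G χ : ℝ × ℝ → ℝ} {z : ℝ × ℝ} (hF : DifferentiableAt ℝ F z)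
    (hG : DifferentiableAt ℝ G z) (hχ : DifferentiableAt ℝ χ (F z, G z)) (e : ℝ × ℝ) :
    dirDeriv e χ (F z, G z) * jacobian F G z =
      (dirDeriv (0, 1) G z * e.1 - dirDeriv (0, 1) F z * e.2)
          * dirDeriv (1, 0) (fun w => χ (F w, G w)) z
        + (dirDeriv (1, 0) F z * e.2 - dirDeriv (1, 0) G z * e.1)
          * dirDeriv (0, 1) (fun w => χ (F w, G w)) z := by
  have hlin : ∀ w : ℝ × ℝ, dirDeriv w χ (F z, G z)
      = w.1 * dirDeriv (1, 0) χ (F z, G z) + w.2 * dirDeriv (0, 1) χ (F z, G z) := by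
    intro w
    have hw : w = w.1 • ((1 : ℝ), (0 : ℝ)) + w.2 • ((0 : ℝ), (1 : ℝ)) := by ext <;> simp
    simp only [dirDeriv]
    conv_lhs => rw [hw]
    simp only [map_add, map_smul, smul_eq_mul]
  have hcomp : ∀ v, dirDeriv v (fun w => χ (F w, G w)) z
      = dirDeriv (dirDeriv v F z, dirDeriv v G z) χ (F z, G z) := by
    intro v
    have h := hχ.hasFDerivAt.comp z (hF.hasFDerivAt.prodMk hG.hasFDerivAt)
    have h' : fderiv ℝ (fun w => χ (F w, G w)) z = _ := h.fderiv
    simp only [dirDeriv]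
    rw [h']
    rfl
  rw [hlin e, hcomp, hcomp, hlin (dirDeriv (1, 0) F z, _), hlin (dirDeriv (0, 1) F z, _), jacobian]
  ring

theorem HasJetLimits.const_mul {U : Set (ℝ × ℝ)} {x : ℝ × ℝ} {j : ℕ} {f : ℝ × ℝ → ℝ}
    (hU : IsOpen U) (c : ℝ) (hf : HasJetLimits ⊤ U x j f) :
    HasJetLimits ⊤ U x j (fun z => c * f z) :=
  (HasJetLimits.of_contDiffOn hU (subset_univ _) uniqueDiffOn_univ (mem_univ x)
    (contDiffOn_const (c := c))).mul hU hf

/-- If the map `(F, G)` and the composition `χ ∘ (F, G)` have limits of derivatives of order at most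
`j + 1`, and the Jacobian determinant of `(F, G)` does not tend to zero, then the compositions of the
first derivatives of `χ` with `(F, G)` have limits of derivatives of order at most `j`. -/
theorem HasJetLimits.dirDeriv_comp {U : Set (ℝ × ℝ)} {x : ℝ × ℝ} {j : ℕ} {F G χ : ℝ × ℝ → ℝ}
    (hU : IsOpen U) (hF : HasJetLimits ⊤ U x (j + 1) F) (hG : HasJetLimits ⊤ U x (j + 1) G)
    {c : ℝ} (hc : c ≠ 0) (hJ : Tendsto (jacobian F G) (𝓝[U] x) (𝓝 c))
    (hχ : ∀ z ∈ U, DifferentiableAt ℝ χ (F z, G z))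
    (h : HasJetLimits ⊤ U x (j + 1) (fun z => χ (F z, G z))) (e : ℝ × ℝ) :
    HasJetLimits ⊤ U x j (fun z => dirDeriv e χ (F z, G z)) := by
  have hneg : ∀ {f g : ℝ × ℝ → ℝ} (a b : ℝ), HasJetLimits ⊤ U x j f → HasJetLimits ⊤ U x j g →
      HasJetLimits ⊤ U x j (fun z => f z * a - g z * b) := fun a b hf hg =>
    ((hf.const_mul hU a).add hU (hg.const_mul hU (-b))).congr hU
      (Eventually.of_forall fun z => by ring)
  have hjac : HasJetLimits ⊤ U x j (jacobian F G) :=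
    (hneg 1 1 ((hF.2.2 (1, 0)).mul hU (hG.2.2 (0, 1)))
      ((hF.2.2 (0, 1)).mul hU (hG.2.2 (1, 0)))).congr hU
      (Eventually.of_forall fun z => by simp only [jacobian]; ring)
  have hnum := ((hneg e.1 e.2 (hG.2.2 (0, 1)) (hF.2.2 (0, 1))).mul hU (h.2.2 (1, 0))).add hU
    ((hneg e.2 e.1 (hF.2.2 (1, 0)) (hG.2.2 (1, 0))).mul hU (h.2.2 (0, 1)))
  refine (hnum.mul hU (hjac.inv hU hc hJ)).congr hU ?_
  filter_upwards [self_mem_nhdsWithin, hF.2.1, hG.2.1, hJ.eventually_ne hc] with z hz h1 h2 h3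
  rw [← dirDeriv_mul_jacobian h1 h2 (hχ z hz) e, mul_assoc, mul_inv_cancel₀ h3, mul_one]

theorem contDiffOn_dirDeriv {Ω : Set (ℝ × ℝ)} (hΩ : IsOpen Ω) {j : ℕ} {χ : ℝ × ℝ → ℝ}
    (hχ : ContDiffOn ℝ (j + 1 : ℕ) χ Ω) (e : ℝ × ℝ) : ContDiffOn ℝ j (dirDeriv e χ) Ω :=
  (hχ.fderiv_of_isOpen hΩ (by simp)).clm_apply contDiffOn_const

theorem contDiffOn_iterate_dirDeriv {Ω : Set (ℝ × ℝ)} (hΩ : IsOpen Ω) {j : ℕ} (m : ℕ)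
    {χ : ℝ × ℝ → ℝ} (hχ : ContDiffOn ℝ (j + m : ℕ) χ Ω) (e : ℝ × ℝ) :
    ContDiffOn ℝ j ((dirDeriv e)^[m] χ) Ω := by
  induction m generalizing χ with
  | zero => exact hχ
  | succ m ih => exact ih (contDiffOn_dirDeriv hΩ (j := j + m) hχ e)

theorem HasJetLimits.iterate_dirDeriv_comp {U Ω : Set (ℝ × ℝ)} {x : ℝ × ℝ} {j : ℕ}
    {F G χ : ℝ × ℝ → ℝ} (hU : IsOpen U) (hΩ : IsOpen Ω) (hmaps : ∀ z ∈ U, (F z, G z) ∈ Ω)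
    {c : ℝ} (hc : c ≠ 0) (hJ : Tendsto (jacobian F G) (𝓝[U] x) (𝓝 c)) (m : ℕ)
    (hF : HasJetLimits ⊤ U x (j + m) F) (hG : HasJetLimits ⊤ U x (j + m) G)
    (hχ : ContDiffOn ℝ (j + m : ℕ) χ Ω)
    (h : HasJetLimits ⊤ U x (j + m) (fun z => χ (F z, G z))) (e : ℝ × ℝ) :
    HasJetLimits ⊤ U x j (fun z => (dirDeriv e)^[m] χ (F z, G z)) := by
  induction m generalizing χ with
  | zero => exact h
  | succ m ih =>
    refine ih hF.pred hG.pred (contDiffOn_dirDeriv hΩ (j := j + m) hχ e)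
      (HasJetLimits.dirDeriv_comp hU hF hG hc hJ (fun z hz => ?_) h e)
    exact (hχ.contDiffAt (hΩ.mem_nhds (hmaps z hz))).differentiableAt (by simp)

/-- This links one-variable iterated derivatives along coordinate lines to iterates of `dirDeriv`.
-/
theorem iteratedDeriv_line {Ω : Set (ℝ × ℝ)} (hΩ : IsOpen Ω) (m : ℕ) {χ : ℝ × ℝ → ℝ}
    (hχ : ContDiffOn ℝ m χ Ω) (c e : ℝ × ℝ) (t : ℝ) (ht : c + t • e ∈ Ω) :
    iteratedDeriv m (fun s => χ (c + s • e)) t = (dirDeriv e)^[m] χ (c + t • e) := by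
  induction m generalizing t with
  | zero => simp
  | succ m ih =>
    have hline : ∀ s, HasDerivAt (fun s : ℝ => c + s • e) e s := fun s => by
      simpa using ((hasDerivAt_id s).smul_const e).const_add c
    have hev : iteratedDeriv m (fun s => χ (c + s • e))
        =ᶠ[𝓝 t] fun s => (dirDeriv e)^[m] χ (c + s • e) := by
      filter_upwards [(hline t).continuousAt.eventually_mem (hΩ.mem_nhds ht)] with s hs
      exact ih (hχ.of_le (by simp)) s hs
    have hd : DifferentiableAt ℝ ((dirDeriv e)^[m] χ) (c + t • e) :=
      ((contDiffOn_iterate_dirDeriv hΩ (j := 1) m (by rwa [add_comm]) e).contDiffAt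
        (hΩ.mem_nhds ht)).differentiableAt (by simp)
    rw [iteratedDeriv_succ, hev.deriv_eq, Function.iterate_succ_apply']
    exact (hd.hasFDerivAt.comp_hasDerivAt t (hline t)).deriv

theorem planeDeriv_eq {Ω : Set (ℝ × ℝ)} (hΩ : IsOpen Ω) (a b : ℕ) {χ : ℝ × ℝ → ℝ}
    (hχ : ContDiffOn ℝ (a + b : ℕ) χ Ω) {x : ℝ × ℝ} (hx : x ∈ Ω) :
    planeDeriv a b χ x = (dirDeriv (1, 0))^[a] ((dirDeriv (0, 1))^[b] χ) x := by
  have hinner : ∀ y ∈ Ω, iteratedDeriv b (fun s => χ (y.1, s)) y.2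
      = (dirDeriv (0, 1))^[b] χ y := fun y hy => by
    simpa using iteratedDeriv_line hΩ b (hχ.of_le (by simp)) (y.1, 0) (0, 1) y.2 (by simpa using hy)
  have hev : (fun s => iteratedDeriv b (fun t => χ (s, t)) x.2)
      =ᶠ[𝓝 x.1] fun s => (dirDeriv (0, 1))^[b] χ (s, x.2) := by
    have hc : ContinuousAt (fun s : ℝ => (s, x.2)) x.1 := by fun_prop
    filter_upwards [hc.eventually_mem (hΩ.mem_nhds hx)] with s hs
    exact hinner _ hs
  rw [planeDeriv, hev.iteratedDeriv_eq]
  simpa using iteratedDeriv_line hΩ a (contDiffOn_iterate_dirDeriv hΩ b hχ (0, 1)) (0, x.2) (1, 0)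
    x.1 (by simpa using hx)

/-! ### Approaching the boundary of the physical domain -/

theorem isCompact_box : IsCompact box := isCompact_Icc.prod isCompact_Icc

theorem collapse_mem_triangle {z : ℝ × ℝ} (hz : z ∈ box) : collapse z ∈ triangle :=
  ⟨hz.1.1, hz.1.2, mul_nonneg hz.1.1 hz.2.1, mul_le_of_le_one_right hz.1.1 hz.2.2⟩

theorem continuous_collapse : Continuous collapse :=
  continuous_fst.prodMk (continuous_fst.mul continuous_snd)

/-- By compactness `H⁻¹` converges along every ultrafilter tending to `y`. Its limit and a fixed
preimage `ξ` of `y` have the same image under `H`, so they coincide or both lie on the collapsed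
edge; `collapse` sends them to the same point either way. -/
theorem exists_tendsto_collapse_invFunOn {H : ℝ × ℝ → ℝ × ℝ} (hH : ContinuousOn H box)
    (hinj : ∀ x ∈ box, ∀ y ∈ box, H x = H y → x = y ∨ (x.1 = 0 ∧ y.1 = 0)) {y : ℝ × ℝ}
    (hy : y ∈ closure (physicalDomain H)) :
    ∃ z ∈ triangle, Tendsto (fun w => collapse (Function.invFunOn H openBox w))
      (𝓝[physicalDomain H] y) (𝓝[openTriangle] z) := by
  have hsub : closure (physicalDomain H) ⊆ H '' box :=
    (isCompact_box.image_of_continuousOn hH).isClosed.closure_subset_iff.2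
      (image_mono openBox_subset_box)
  obtain ⟨ξ, hξ, rfl⟩ := hsub hy
  have hmem : ∀ᶠ w in 𝓝[physicalDomain H] H ξ, w ∈ physicalDomain H := self_mem_nhdsWithin
  refine ⟨collapse ξ, collapse_mem_triangle hξ, tendsto_nhdsWithin_iff.2 ⟨?_, ?_⟩⟩
  · rw [tendsto_iff_ultrafilter]
    intro u hu
    have hinv : ∀ᶠ w in (u : Filter (ℝ × ℝ)), Function.invFunOn H openBox w ∈ box ∧
        H (Function.invFunOn H openBox w) = w := by
      filter_upwards [hu hmem] with w hw
      exact ⟨openBox_subset_box (Function.invFunOn_mem hw), Function.invFunOn_eq hw⟩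
    obtain ⟨η, hη, hlim⟩ := isCompact_box.ultrafilter_le_nhds
      (u.map (Function.invFunOn H openBox)) (le_principal_iff.2 (hinv.mono fun _ h => h.1))
    have hlim' : Tendsto (Function.invFunOn H openBox) u (𝓝[box] η) :=
      tendsto_nhdsWithin_iff.2 ⟨hlim, hinv.mono fun _ h => h.1⟩
    have h1 : Tendsto (fun w => H (Function.invFunOn H openBox w)) u (𝓝 (H η)) :=
      (hH η hη).tendsto.comp hlim'
    have h2 : Tendsto (fun w => H (Function.invFunOn H openBox w)) u (𝓝 (H ξ)) :=
      Tendsto.congr' (f₁ := id) (hinv.mono fun _ h => h.2.symm) (hu.trans nhdsWithin_le_nhds)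
    have h3 : collapse η = collapse ξ := by
      rcases hinj η hη ξ hξ (tendsto_nhds_unique h1 h2) with h | ⟨h, h'⟩
      · rw [h]
      · simp [collapse, h, h']
    rw [← h3]
    exact (continuous_collapse.tendsto η).comp hlim
  · filter_upwards [hmem] with w hw
    exact mapsTo_collapse_openBox (Function.invFunOn_mem hw)

theorem mem_puncturedTriangle_or_eq_zero {z : ℝ × ℝ} (hz : z ∈ triangle) :
    z ∈ puncturedTriangle ∨ z = 0 := by
  rcases hz.1.eq_or_lt with h | h
  · right
    have h2 : z.2 = 0 := le_antisymm (h ▸ hz.2.2.2) hz.2.2.1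
    exact Prod.ext h.symm h2
  · exact Or.inl ⟨hz, h⟩

/-- A constant patch has zero derivative. This excludes `k = 0`, so that `G` is at least `C¹` and
the inverse function theorem applies. -/
theorem not_isRegularOn_of_totalDegree_eq_zero {ϱ : Fin 3 → MvPolynomial (Fin 2) ℝ}
    (hdeg : ∀ i, ϱ i ∈ MvPolynomial.restrictTotalDegree (Fin 2) ℝ 0) :
    ¬ IsRegularOn (ratMap fun i => polyFun (ϱ i)) triangle triangle := by
  intro h
  have hconst : ∀ i x, polyFun (ϱ i) x = polyFun (ϱ i) 0 := by
    intro i x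
    have h0 : (ϱ i).totalDegree = 0 :=
      Nat.le_zero.1 ((MvPolynomial.mem_restrictTotalDegree _ _ _).1 (hdeg i))
    rw [MvPolynomial.totalDegree_eq_zero_iff_eq_C] at h0
    rw [h0]
    simp [polyFun]
  have hrat : (ratMap fun i => polyFun (ϱ i))
      = fun _ => ratMap (fun i => polyFun (ϱ i)) 0 := by
    ext x <;> simp only [ratMap, hconst _ x]
  refine h 0 ⟨le_rfl, zero_le_one, le_rfl, le_rfl⟩ ?_
  rw [hrat, fderivWithin_fun_const, det_eq]
  simp

theorem hasJetLimits_comp_uncollapse {p q N₁ N₂ k : ℕ} {S : OpenKnotVector p N₁}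
    {T : OpenKnotVector q N₂} (hS : ∀ f ∈ splineSpace S T, ContDiffOn ℝ k f box)
    {f : ℝ × ℝ → ℝ} (hf : f ∈ constrainedSpace k S T) {z : ℝ × ℝ} (hz : z ∈ triangle) :
    HasJetLimits ⊤ openTriangle z k (fun w => f (uncollapse w)) := by
  rcases mem_puncturedTriangle_or_eq_zero hz with hz | rfl
  · exact HasJetLimits.of_contDiffOn isOpen_openTriangle openTriangle_subset_puncturedTriangle
      uniqueDiffOn_puncturedTriangle hz
      ((hS f hf.1).comp (contDiffOn_uncollapse k) mapsTo_uncollapse_box)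
  · obtain ⟨h, hh⟩ := exists_hasEdgeExpansion_spline S T hS hf.1
    obtain ⟨ϱ, -, hϱ⟩ := hf.2
    exact (hasJetLimits_remainder hh hϱ).of_remainder

theorem hasJetLimits_div_comp_uncollapse {p q N₁ N₂ k : ℕ} {S : OpenKnotVector p N₁}
    {T : OpenKnotVector q N₂} (hS : ∀ f ∈ splineSpace S T, ContDiffOn ℝ k f box)
    {f g₀ : ℝ × ℝ → ℝ} (hf : f ∈ constrainedSpace k S T) (hg₀ : g₀ ∈ constrainedSpace k S T)
    (hpos : ∀ x ∈ box, 0 < g₀ x) {z : ℝ × ℝ} (hz : z ∈ triangle) :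
    HasJetLimits ⊤ openTriangle z k (fun w => f (uncollapse w) / g₀ (uncollapse w)) := by
  have hg := hasJetLimits_comp_uncollapse hS hg₀ hz
  obtain ⟨c, -, hc⟩ := hg.tendsto
  have hzcl : (𝓝[openTriangle] z).NeBot := by
    -- The segment from `z` to the interior point `(1/2, 1/4)` approaches `z` through the open
    -- triangle.
    have h1 : Tendsto (fun ε : ℝ => ((1 - ε) * z.1 + ε / 2, (1 - ε) * z.2 + ε / 4)) (𝓝[>] 0)
        (𝓝 z) := by
      have : Continuous fun ε : ℝ => ((1 - ε) * z.1 + ε / 2, (1 - ε) * z.2 + ε / 4) := by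
        fun_prop
      have := this.tendsto 0
      simp only [sub_zero, one_mul, zero_div, add_zero, Prod.mk.eta] at this
      exact this.mono_left nhdsWithin_le_nhds
    refine (tendsto_nhdsWithin_iff.2 ⟨h1, ?_⟩).neBot
    filter_upwards [Ioo_mem_nhdsGT (zero_lt_one (α := ℝ))] with ε hε
    obtain ⟨h2, h3, h4, h5⟩ := hz
    have h6 : 0 ≤ 1 - ε := sub_nonneg.2 hε.2.le
    have h7 := mul_le_mul_of_nonneg_left h5 h6
    have h8 := mul_nonneg h6 h4
    have h9 := mul_le_mul_of_nonneg_left h3 h6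
    have h10 := hε.1
    refine ⟨?_, ?_, ?_⟩ <;> dsimp only <;> linarith
  -- The positive minimum of `g₀` on the box bounds the limit `c` from below, so `c ≠ 0`.
  obtain ⟨w, hw, hmin⟩ := isCompact_box.exists_isMinOn (α := ℝ)
    ⟨(0, 0), ⟨le_rfl, zero_le_one⟩, le_rfl, zero_le_one⟩ (hS _ hg₀.1).continuousOn
  have hle : g₀ w ≤ c := by
    refine ge_of_tendsto hc ?_
    filter_upwards [self_mem_nhdsWithin] with v hv
    exact hmin (openBox_subset_box (mapsTo_uncollapse_openTriangle hv))
  simp only [div_eq_mul_inv]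
  exact (hasJetLimits_comp_uncollapse hS hf hz).mul isOpen_openTriangle
    (hg.inv isOpen_openTriangle ((hpos w hw).trans_le hle).ne' hc)

end SingularPatch

/-! ### The main theorem -/

theorem theorem1 (p q N₁ N₂ k : ℕ) (hp : 1 ≤ p) (hq : 1 ≤ q) (hk : k ≤ min p q)
    (S : SingularPatch.OpenKnotVector p N₁) (T : SingularPatch.OpenKnotVector q N₂)
    -- the spline space is contained in `C^k` of the closed box
    (hS : ∀ f ∈ SingularPatch.splineSpace S T, ContDiffOn ℝ k f SingularPatch.box)
    -- the homogeneous components of the parameterization, with positive weight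
    (g : Fin 3 → ℝ × ℝ → ℝ)
    (hg : ∀ i, g i ∈ SingularPatch.constrainedSpace k S T)
    (hpos : ∀ x ∈ SingularPatch.box, 0 < g 0 x)
    -- the parameterization is one-to-one on the closed box, up to the collapsed edge
    (hinj : ∀ x ∈ SingularPatch.box, ∀ y ∈ SingularPatch.box,
      SingularPatch.ratMap g x = SingularPatch.ratMap g y → x = y ∨ (x.1 = 0 ∧ y.1 = 0))
    -- it is regular for `s > 0`
    (hreg : SingularPatch.IsRegularOn (SingularPatch.ratMap g) SingularPatch.box
      (Set.Ioc 0 1 ×ˢ Set.Icc 0 1))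
    -- the equivalent triangular patch
    (ϱ : Fin 3 → MvPolynomial (Fin 2) ℝ)
    (hdeg : ∀ i, ϱ i ∈ MvPolynomial.restrictTotalDegree (Fin 2) ℝ k)
    (hequiv : ∀ i, SingularPatch.EquivAtEdge k (g i) (ϱ i))
    -- it is well defined and regular on the triangle
    (hne : ∀ x ∈ SingularPatch.triangle, SingularPatch.polyFun (ϱ 0) x ≠ 0)
    (hregϱ : SingularPatch.IsRegularOn
      (SingularPatch.ratMap fun i => SingularPatch.polyFun (ϱ i))
      SingularPatch.triangle SingularPatch.triangle) :
    SingularPatch.isogeometricSpace g (SingularPatch.constrainedSpace k S T) ⊆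
      SingularPatch.CkClosure k
        (SingularPatch.physicalDomain (SingularPatch.ratMap g)) := by
  open SingularPatch in
  rintro φ ⟨f, hf, hφ⟩
  rcases Nat.eq_zero_or_pos k with rfl | hkpos
  · exact absurd hregϱ (not_isRegularOn_of_totalDegree_eq_zero hdeg)
  have hgs : ∀ i, ContDiffOn ℝ k (g i) box := fun i => hS _ (hg i).1
  have hG : ContDiffOn ℝ k (ratMap g) box := contDiffOn_ratMap hgs fun x hx => (hpos x hx).ne'
  have hinjOn : InjOn (ratMap g) openBox := fun x hx y hy hxy =>
    (hinj x (openBox_subset_box hx) y (openBox_subset_box hy) hxy).resolve_right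
      fun h => hx.1.1.ne' h.1
  have hdet : ∀ z ∈ openBox, (fderiv ℝ (ratMap g) z).det ≠ 0 := fun z hz => by
    have h := hreg z ⟨Ioo_subset_Ioc_self hz.1, Ioo_subset_Icc_self hz.2⟩
    rwa [fderivWithin_of_mem_nhds
      (mem_of_superset (isOpen_openBox.mem_nhds hz) openBox_subset_box)] at h
  obtain ⟨hΩ, hinv⟩ := isOpen_image_and_contDiffOn_invFunOn hkpos.ne' isOpen_openBox
    (hG.mono openBox_subset_box) hinjOn hdet
  have hφC : ContDiffOn ℝ k φ (physicalDomain (ratMap g)) := by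
    have h1 : ContDiffOn ℝ k (fun x => f x / g 0 x) openBox :=
      ((hS f hf.1).div (hgs 0) fun x hx => (hpos x hx).ne').mono openBox_subset_box
    exact (h1.comp hinv fun y hy => Function.invFunOn_mem hy).congr hφ
  refine ⟨hφC, fun x hx a b hab => ?_⟩
  obtain ⟨z, hz, hlim⟩ := exists_tendsto_collapse_invFunOn hG.continuousOn hinj hx.1
  have hmaps : ∀ w ∈ openTriangle, ratMap g (uncollapse w) ∈ physicalDomain (ratMap g) :=
    fun w hw => mem_image_of_mem _ (mapsTo_uncollapse_openTriangle hw)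
  obtain ⟨c, hc, hJ⟩ : ∃ c ≠ 0, Tendsto (jacobian (fun w => (ratMap g (uncollapse w)).1)
      (fun w => (ratMap g (uncollapse w)).2)) (𝓝[openTriangle] z) (𝓝 c) := by
    rcases mem_puncturedTriangle_or_eq_zero hz with hz' | rfl
    · exact tendsto_jacobian_of_mem_puncturedTriangle hkpos.ne' hG hz'
        (hreg _ (mapsTo_uncollapse_puncturedTriangle hz'))
    · refine ⟨_, hregϱ 0 hz, tendsto_jacobian_zero (k := k - 1)
        (N := fun i w => g i (uncollapse w)) (fun i => ?_) (hne 0 hz)⟩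
      obtain ⟨h, hh⟩ := exists_hasEdgeExpansion_spline S T hS (hg i).1
      rw [Nat.sub_add_cancel hkpos]
      exact hasJetLimits_remainder hh (hequiv i)
  have hjet : ∀ {f}, f ∈ constrainedSpace k S T → HasJetLimits ⊤ openTriangle z (a + b)
      (fun w => f (uncollapse w) / g 0 (uncollapse w)) := fun hf =>
    (hasJetLimits_div_comp_uncollapse hS hf (hg 0) hpos hz).mono hab
  have hjetφ : HasJetLimits ⊤ openTriangle z (a + b)
      (fun w => φ ((ratMap g (uncollapse w)).1, (ratMap g (uncollapse w)).2)) := by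
    refine (hjet hf).congr isOpen_openTriangle ?_
    filter_upwards [self_mem_nhdsWithin] with w hw
    rw [Prod.mk.eta, hφ (hmaps w hw), Function.comp_apply,
      hinjOn.leftInvOn_invFunOn (mapsTo_uncollapse_openTriangle hw)]
  have hφab : ContDiffOn ℝ (a + b : ℕ) φ (physicalDomain (ratMap g)) :=
    hφC.of_le (by exact_mod_cast hab)
  -- The `b` derivatives in the second variable come first, as in `planeDeriv`, leaving `a` orders
  -- for the first variable.
  have h1 := HasJetLimits.iterate_dirDeriv_comp isOpen_openTriangle hΩ hmaps hc hJ b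
    (hjet (hg 1)) (hjet (hg 2)) hφab hjetφ (0, 1)
  have h2 := HasJetLimits.iterate_dirDeriv_comp (j := 0) isOpen_openTriangle hΩ hmaps hc hJ a
    ((hjet (hg 1)).mono (by omega)) ((hjet (hg 2)).mono (by omega))
    (by rw [zero_add]; exact contDiffOn_iterate_dirDeriv hΩ b hφab (0, 1))
    (by rw [zero_add]; exact h1) (1, 0)
  obtain ⟨l, -, hl⟩ := h2
  have hlφ : Tendsto (planeDeriv a b φ) (𝓝[physicalDomain (ratMap g)] x) (𝓝 l) := by
    -- Composing with `u ∘ G⁻¹` cancels `G ∘ u⁻¹`.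
    refine (hl.comp hlim).congr' ?_
    filter_upwards [self_mem_nhdsWithin] with y hy
    have hy' := Function.invFunOn_mem hy
    rw [Function.comp_apply, uncollapse_collapse hy'.1.1.ne', planeDeriv_eq hΩ a b hφab hy]
    exact congrArg _ (Function.invFunOn_eq hy)
  have := mem_closure_iff_nhdsWithin_neBot.1 hx.1
  exact ⟨l, hlφ, fun l' hl' => tendsto_nhds_unique hl' hlφ⟩
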